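/- For a graph $G$ (all graphs are finite, undirected, without loops or multiple edges), the clique-width of $G$ is the minimum number of labels needed to construct $G$ by the following four operations: (1) creating a new graph consisting of a single vertex with label $i$; (2) taking the disjoint union of two labelled graphs; (3) joining each vertex with label $i$ to each vertex with label $j$, where $i\neq j$; (4) renaming label $i$ to $j$. A class of graphs has bounded clique-width if there is a constant $c$ such that every graph in the class has clique-width at most $c$; otherwise it has unbounded clique-width. For graphs $H_1,\dots,H_p$, a graph is $(H_1,\dots,H_p)$-free if it has no induced subgraph isomorphic to any $H_i$. Here $C_r$, $P_r$ and $K_r$ are the cycle, path and complete graph on $r$ vertices, $K_{1,3}$ is the claw, and $\overline{2P_1+P_2}$ (the diamond) is the complement of the disjoint union of two copies of $P_1$ and one copy of $P_2$. **Theorem.** The class of $(C_4, C_5, K_{1,3}, K_4, \overline{2P_1+P_2})$-free graphs has unbounded clique-width. -/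

import Mathlib

open scoped SimpleGraph

/-- Expressions over the label set `Fin k` built from the four clique-width operations. -/
inductive CWExpr (k : ℕ) : Type
  /-- a new graph consisting of a single vertex with label `i` -/
  | vertex (i : Fin k) : CWExpr k
  /-- the disjoint union of two labelled graphs -/
  | union (s t : CWExpr k) : CWExpr k
  /-- join each vertex with label `i` to each vertex with label `j`, where `i ≠ j` -/
  | join (i j : Fin k) (hij : i ≠ j) (t : CWExpr k) : CWExpr k
  /-- rename label `i` to `j` -/
  | relabel (i j : Fin k) (t : CWExpr k) : CWExpr k

namespace CWExpr

variable {k : ℕ}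

/-- The vertex set of the labelled graph built by an expression. -/
def Vertex : CWExpr k → Type
  | vertex _ => Unit
  | union s t => s.Vertex ⊕ t.Vertex
  | join _ _ _ t => t.Vertex
  | relabel _ _ t => t.Vertex

/-- The labelling of the labelled graph built by an expression. -/
def label : (t : CWExpr k) → t.Vertex → Fin k
  | vertex i => fun _ => i
  | union s t => Sum.elim s.label t.label
  | join _ _ _ t => t.label
  | relabel i j t => fun v => if t.label v = i then j else t.label v

/-- The graph built by an expression. -/
def graph : (t : CWExpr k) → SimpleGraph t.Vertex
  | vertex _ => ⊥
  | union s t => s.graph ⊕g t.graph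
  | join i j hij t =>
    { Adj := fun u v => t.graph.Adj u v ∨
        (t.label u = i ∧ t.label v = j) ∨ (t.label u = j ∧ t.label v = i)
      symm := ⟨fun u v h => by
        rcases h with h | h | h
        · exact Or.inl h.symm
        · exact Or.inr (Or.inr h.symm)
        · exact Or.inr (Or.inl h.symm)⟩
      loopless := ⟨fun u h => by
        rcases h with h | h | h
        · exact t.graph.loopless.irrefl u h
        · exact hij (h.1.symm.trans h.2)
        · exact hij (h.2.symm.trans h.1)⟩ }
  | relabel _ _ t => t.graph

end CWExpr

/-- `G` can be constructed by the four operations using at most `k` labels. The graph without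
vertices needs no operation, hence no label. -/
def SimpleGraph.ConstructibleWith {V : Type*} (G : SimpleGraph V) (k : ℕ) : Prop :=
  IsEmpty V ∨ ∃ t : CWExpr k, Nonempty (G ≃g t.graph)

/-- The clique-width of a graph: the minimum number of labels needed to construct it
(`⊤` if it cannot be constructed, which happens for infinite graphs only). -/
noncomputable def SimpleGraph.cliqueWidth {V : Type*} (G : SimpleGraph V) : ℕ∞ :=
  ⨅ (k : ℕ) (_ : G.ConstructibleWith k), (k : ℕ∞)

/-- Finite simple graphs. -/
structure FiniteGraph : Type 1 where
  /-- the vertex set -/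
  V : Type
  /-- the vertex set is finite -/
  [finite : Finite V]
  /-- the graph on this vertex set -/
  graph : SimpleGraph V

/-- A simple graph on a finite type, as a `FiniteGraph`. -/
abbrev SimpleGraph.toFiniteGraph {V : Type} [Finite V] (G : SimpleGraph V) : FiniteGraph :=
  ⟨V, G⟩

/-- The class of all finite graphs that have no induced subgraph isomorphic to a graph in `ℋ`. -/
def freeClass (ℋ : Set FiniteGraph) : Set FiniteGraph :=
  {G | ∀ H ∈ ℋ, ¬ H.graph ⊴ G.graph}

/-- A class of graphs has bounded clique-width if some constant `c` bounds the clique-width of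
all its members. -/
def HasBoundedCliqueWidth (𝒢 : Set FiniteGraph) : Prop :=
  ∃ c : ℕ, ∀ G ∈ 𝒢, G.graph.cliqueWidth ≤ c

/-- The cycle on four vertices. -/
abbrev graphC4 : SimpleGraph (Fin 4) := SimpleGraph.cycleGraph 4

/-- The cycle on five vertices. -/
abbrev graphC5 : SimpleGraph (Fin 5) := SimpleGraph.cycleGraph 5

/-- The claw `K_{1,3}`. -/
abbrev graphClaw : SimpleGraph (Fin 1 ⊕ Fin 3) := completeBipartiteGraph (Fin 1) (Fin 3)

/-- The complete graph on four vertices. -/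
abbrev graphK4 : SimpleGraph (Fin 4) := ⊤

/-- The diamond, which is the complement of `2P₁ + P₂`. -/
abbrev graphDiamond : SimpleGraph ((Fin 1 ⊕ Fin 1) ⊕ Fin 2) :=
  ((SimpleGraph.pathGraph 1 ⊕g SimpleGraph.pathGraph 1) ⊕g SimpleGraph.pathGraph 2)ᶜ

/-! The witnesses are toroidal `m × m` grids whose vertices are replaced by two linked triangles,
one for row links and one for column links. These are disjoint triangles plus a perfect matching. A
neighbourhood is a clique plus one vertex, so there is no claw. Triangles lie inside fibres of size
three, which excludes `K₄` and the diamond. Longer induced cycles alternate clique and matching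
edges, which excludes `C₅`; a `C₄` would need two matching edges between the same two triangles.

An expression with `k` labels yields a balanced set `A` with at most `k` types of outside
neighbourhood (`exists_isCutLabelling`). By bounded degree, at most `4k` vertices of `A` have
outside neighbours (`card_innerBoundary_le`). In the torus such a small boundary forces `A` or its
complement to be small (`truncatedTorus_isoperimetric`), a contradiction for `m > 12k`. -/

open Finset

/-! ### Balanced cuts with few neighbourhood types -/

namespace CWExpr

variable {k : ℕ}

theorem finite_vertex (t : CWExpr k) : Finite t.Vertex := by
  induction t with
  | vertex i => exact inferInstanceAs (Finite Unit)
  | union s t hs ht => exact inferInstanceAs (Finite (s.Vertex ⊕ t.Vertex))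
  | join i j hij t ht => exact ht
  | relabel i j t ht => exact ht

/-- The set `A` is divided by `l` into classes whose members have the same label and the same
neighbours outside `A`. -/
def IsCutLabelling (t : CWExpr k) (A : Set t.Vertex) (l : t.Vertex → Fin k) : Prop :=
  ∀ u ∈ A, ∀ v ∈ A, l u = l v →
    t.label u = t.label v ∧ ∀ w ∉ A, t.graph.Adj u w → t.graph.Adj v w

theorem isCutLabelling_univ (t : CWExpr k) : t.IsCutLabelling Set.univ t.label :=
  fun _ _ _ _ h => ⟨h, fun w hw => absurd (Set.mem_univ w) hw⟩

/-- A join sees only labels, so vertices of one class gain the same neighbours. This is why the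
invariant records equality of labels. -/
theorem IsCutLabelling.join {t : CWExpr k} {A : Set t.Vertex} {l : t.Vertex → Fin k}
    (h : t.IsCutLabelling A l) (i j : Fin k) (hij : i ≠ j) :
    (CWExpr.join i j hij t).IsCutLabelling A l := by
  intro u hu v hv huv
  obtain ⟨h1, h2⟩ := h u hu v hv huv
  refine ⟨h1, fun w hw huw => ?_⟩
  rcases huw with huw | huw | huw
  · exact Or.inl (h2 w hw huw)
  · exact Or.inr (Or.inl ⟨h1.symm.trans huw.1, huw.2⟩)
  · exact Or.inr (Or.inr ⟨h1.symm.trans huw.1, huw.2⟩)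

theorem IsCutLabelling.relabel {t : CWExpr k} {A : Set t.Vertex} {l : t.Vertex → Fin k}
    (h : t.IsCutLabelling A l) (i j : Fin k) :
    (CWExpr.relabel i j t).IsCutLabelling A l := by
  intro u hu v hv huv
  obtain ⟨h1, h2⟩ := h u hu v hv huv
  refine ⟨?_, h2⟩
  change (if t.label u = i then j else t.label u) = if t.label v = i then j else t.label v
  rw [h1]

theorem IsCutLabelling.union_left {s : CWExpr k} {A : Set s.Vertex} {l : s.Vertex → Fin k}
    (h : s.IsCutLabelling A l) (t : CWExpr k) :
    (CWExpr.union s t).IsCutLabelling (Sum.inl '' A) (Sum.elim l t.label) := by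
  rintro _ ⟨u, hu, rfl⟩ _ ⟨v, hv, rfl⟩ huv
  obtain ⟨h1, h2⟩ := h u hu v hv huv
  refine ⟨h1, ?_⟩
  rintro (w | w) hw huw
  · exact h2 w (fun hA => hw ⟨w, hA, rfl⟩) huw
  · exact huw

theorem IsCutLabelling.union_right {t : CWExpr k} {A : Set t.Vertex} {l : t.Vertex → Fin k}
    (h : t.IsCutLabelling A l) (s : CWExpr k) :
    (CWExpr.union s t).IsCutLabelling (Sum.inr '' A) (Sum.elim s.label l) := by
  rintro _ ⟨u, hu, rfl⟩ _ ⟨v, hv, rfl⟩ huv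
  obtain ⟨h1, h2⟩ := h u hu v hv huv
  refine ⟨h1, ?_⟩
  rintro (w | w) hw huw
  · exact huw
  · exact h2 w (fun hA => hw ⟨w, hA, rfl⟩) huw

/-- Descend the expression, at each union of size at least `2 * N` into a part of size at least `N`.
The operations above the chosen subexpression preserve the classes. -/
theorem exists_isCutLabelling (t : CWExpr k) {N : ℕ} (hN : 1 ≤ N) (ht : N ≤ Nat.card t.Vertex) :
    ∃ (A : Set t.Vertex) (l : t.Vertex → Fin k),
      N ≤ A.ncard ∧ A.ncard < 2 * N ∧ t.IsCutLabelling A l := by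
  have of_small (t : CWExpr k) (ht : N ≤ Nat.card t.Vertex) (hlt : Nat.card t.Vertex < 2 * N) :
      ∃ (A : Set t.Vertex) (l : t.Vertex → Fin k),
        N ≤ A.ncard ∧ A.ncard < 2 * N ∧ t.IsCutLabelling A l :=
    ⟨Set.univ, t.label, by rwa [Set.ncard_univ], by rwa [Set.ncard_univ], t.isCutLabelling_univ⟩
  induction t with
  | vertex i =>
    have h1 : Nat.card (CWExpr.vertex i).Vertex = 1 := Nat.card_unique (α := Unit)
    exact of_small _ ht (by omega)
  | union s t hs ht' =>
    have := s.finite_vertex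
    have := t.finite_vertex
    have hcard : Nat.card (CWExpr.union s t).Vertex = Nat.card s.Vertex + Nat.card t.Vertex :=
      Nat.card_sum
    by_cases hlt : Nat.card (CWExpr.union s t).Vertex < 2 * N
    · exact of_small _ ht hlt
    have key : N ≤ Nat.card s.Vertex ∨ N ≤ Nat.card t.Vertex := by omega
    rcases key with key | key
    · obtain ⟨A, l, h1, h2, h3⟩ := hs key
      have hA := Set.ncard_image_of_injective A (Sum.inl_injective (β := t.Vertex))
      exact ⟨Sum.inl '' A, _, hA ▸ h1, hA ▸ h2, h3.union_left t⟩
    · obtain ⟨A, l, h1, h2, h3⟩ := ht' key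
      have hA := Set.ncard_image_of_injective A (Sum.inr_injective (α := s.Vertex))
      exact ⟨Sum.inr '' A, _, hA ▸ h1, hA ▸ h2, h3.union_right s⟩
  | join i j hij t ih =>
    obtain ⟨A, l, h1, h2, h3⟩ := ih ht
    exact ⟨A, l, h1, h2, h3.join i j hij⟩
  | relabel i j t ih =>
    obtain ⟨A, l, h1, h2, h3⟩ := ih ht
    exact ⟨A, l, h1, h2, h3.relabel i j⟩

end CWExpr

namespace SimpleGraph

variable {V : Type*} {G : SimpleGraph V}

theorem exists_constructibleWith_of_cliqueWidth_le {c : ℕ} (h : G.cliqueWidth ≤ c) :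
    ∃ k ≤ c, G.ConstructibleWith k := by
  by_contra! hk
  have : ((c + 1 : ℕ) : ℕ∞) ≤ G.cliqueWidth := by
    refine le_iInf fun k => le_iInf fun hG => ?_
    exact_mod_cast not_le.mp fun hkc => hk k hkc hG
  have := this.trans h
  rw [Nat.cast_le] at this
  omega

theorem ConstructibleWith.exists_cut [Fintype V] {k N : ℕ} (hG : G.ConstructibleWith k)
    (hN : 1 ≤ N) (hV : N ≤ Fintype.card V) :
    ∃ (A : Finset V) (l : V → Fin k), N ≤ #A ∧ #A < 2 * N ∧
      ∀ u ∈ A, ∀ v ∈ A, l u = l v → ∀ w ∉ A, G.Adj u w → G.Adj v w := by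
  classical
  rcases hG with hG | ⟨t, ⟨e⟩⟩
  · have := Fintype.card_eq_zero_iff.mpr hG
    omega
  · have hcard : Nat.card t.Vertex = Fintype.card V := by
      rw [← Nat.card_congr e.toEquiv, Nat.card_eq_fintype_card]
    obtain ⟨A, l, h1, h2, h3⟩ := t.exists_isCutLabelling hN (hcard ▸ hV)
    have hA : #{v | e v ∈ A} = A.ncard := by
      rw [← Set.ncard_coe_finset, ← Set.ncard_preimage_of_injective_subset_range e.injective
        (by rw [e.surjective.range_eq]; exact Set.subset_univ A)]
      congr 1
      ext v
      simp
    refine ⟨univ.filter fun v => e v ∈ A, l ∘ e, hA ▸ h1, hA ▸ h2, fun u hu v hv huv w hw huw => ?_⟩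
    simp only [mem_filter, mem_univ, true_and] at hu hv hw
    exact e.map_adj_iff.mp ((h3 _ hu _ hv huv).2 _ hw (e.map_adj_iff.mpr huw))

open Classical in
/-- The vertices of `A` with a neighbour outside `A`. -/
noncomputable def innerBoundary (G : SimpleGraph V) (A : Finset V) : Finset V :=
  {u ∈ A | ∃ w ∉ A, G.Adj u w}

theorem mem_innerBoundary {A : Finset V} {u : V} :
    u ∈ G.innerBoundary A ↔ u ∈ A ∧ ∃ w ∉ A, G.Adj u w := by
  simp [innerBoundary]

/-- If `u` in a class has a neighbour `w` outside `A`, the whole class is adjacent to `w`, hence has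
at most `d` members. -/
theorem card_innerBoundary_le {k d : ℕ} {A : Finset V} (l : V → Fin k)
    (hl : ∀ u ∈ A, ∀ v ∈ A, l u = l v → ∀ w ∉ A, G.Adj u w → G.Adj v w)
    (hd : ∀ w, ∃ S : Finset V, #S ≤ d ∧ ∀ u, G.Adj u w → u ∈ S) :
    #(G.innerBoundary A) ≤ d * k := by
  classical
  have h := card_le_mul_card_image_of_maps_to (s := G.innerBoundary A) (t := univ) (f := l)
    (fun _ _ => mem_univ _) d ?_
  · simpa using h
  · intro i _
    rcases eq_empty_or_nonempty {u ∈ G.innerBoundary A | l u = i} with h0 | ⟨u, hu⟩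
    · simp [h0]
    · rw [mem_filter, mem_innerBoundary] at hu
      obtain ⟨⟨huA, w, hw, huw⟩, hui⟩ := hu
      obtain ⟨S, hS, hadj⟩ := hd w
      refine (card_le_card fun v hv => ?_).trans hS
      rw [mem_filter, mem_innerBoundary] at hv
      exact hadj v (hl u huA v hv.1.1 (hui.trans hv.2.symm) w hw huw)

/-! ### Graphs composed of disjoint cliques and a perfect matching -/

/-- The graph in which every fibre of `p` is a clique and every vertex is matched by `σ`. -/
def cliqueMatching {B : Type*} (p : V → B) (σ : V → V) (hσ : Function.Involutive σ) :
    SimpleGraph V where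
  Adj u v := u ≠ v ∧ (p u = p v ∨ σ u = v)
  symm := ⟨fun u v ⟨h, h'⟩ => ⟨h.symm, h'.imp Eq.symm fun e => by rw [← e, hσ]⟩⟩
  loopless := ⟨fun _ h => h.1 rfl⟩

section cliqueMatching

variable {B : Type*} {p : V → B} {σ : V → V} {hσ : Function.Involutive σ}

theorem cliqueMatching_adj {u v : V} :
    (cliqueMatching p σ hσ).Adj u v ↔ u ≠ v ∧ (p u = p v ∨ σ u = v) := Iff.rfl

/-- Of two edges at a vertex that do not lie in a triangle, exactly one is a matching edge. -/
theorem cliqueMatching_alternates {u v w : V} (huv : (cliqueMatching p σ hσ).Adj u v)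
    (hvw : (cliqueMatching p σ hσ).Adj v w) (huw : ¬ (cliqueMatching p σ hσ).Adj u w)
    (hne : u ≠ w) : p u = p v ∧ p v ≠ p w ∧ σ v = w ∨ p v = p w ∧ p u ≠ p v ∧ σ u = v := by
  have h := hσ u
  simp only [cliqueMatching_adj] at *
  grind

/-- A matching edge lies in no triangle: both ends have used up their partner, so a common neighbour
would share a fibre with each of them. -/
theorem cliqueMatching_triangle (hp : ∀ u, p (σ u) ≠ p u) {u v w : V}
    (huv : (cliqueMatching p σ hσ).Adj u v) (hvw : (cliqueMatching p σ hσ).Adj v w)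
    (huw : (cliqueMatching p σ hσ).Adj u w) : p u = p v := by
  have h := hσ u
  have h' := hσ v
  have := hp u
  simp only [cliqueMatching_adj] at *
  grind

/-- Clique and matching edges cannot alternate around an odd cycle. -/
theorem cycleGraph_five_not_isIndContained_cliqueMatching :
    ¬ cycleGraph 5 ⊴ cliqueMatching p σ hσ := by
  rintro ⟨f⟩
  have alt (i : Fin 5) := cliqueMatching_alternates (p := p) (hσ := hσ)
    (u := f i) (v := f (i + 1)) (w := f (i + 2))
    (f.map_adj_iff.mpr (by revert i; decide)) (f.map_adj_iff.mpr (by revert i; decide))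
    (fun h => (by decide : ∀ i : Fin 5, ¬ (cycleGraph 5).Adj i (i + 2)) i (f.map_adj_iff.mp h))
    (fun h => (by decide : ∀ i : Fin 5, i ≠ i + 2) i (f.injective h))
  have h0 := alt 0
  have h1 := alt 1
  have h2 := alt 2
  have h3 := alt 3
  have h4 := alt 4
  simp only [Fin.reduceAdd] at h0 h1 h2 h3 h4
  grind

/-- By alternation, two opposite edges are matching edges between the same two fibres, which `hps`
forbids. -/
theorem cycleGraph_four_not_isIndContained_cliqueMatching
    (hps : ∀ u v, p u = p v → p (σ u) = p (σ v) → u = v) :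
    ¬ cycleGraph 4 ⊴ cliqueMatching p σ hσ := by
  rintro ⟨f⟩
  have alt (i : Fin 4) := cliqueMatching_alternates (p := p) (hσ := hσ)
    (u := f i) (v := f (i + 1)) (w := f (i + 2))
    (f.map_adj_iff.mpr (by revert i; decide)) (f.map_adj_iff.mpr (by revert i; decide))
    (fun h => (by decide : ∀ i : Fin 4, ¬ (cycleGraph 4).Adj i (i + 2)) i (f.map_adj_iff.mp h))
    (fun h => (by decide : ∀ i : Fin 4, i ≠ i + 2) i (f.injective h))
  have hne (i : Fin 4) : f i ≠ f (i + 1) :=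
    fun h => (by decide : ∀ i : Fin 4, i ≠ i + 1) i (f.injective h)
  have h0 := alt 0
  have h1 := alt 1
  have h2 := alt 2
  have h3 := alt 3
  have n0 := hne 0
  have n1 := hne 1
  have s0 := hσ (f 0)
  have s1 := hσ (f 1)
  have s2 := hσ (f 2)
  have s3 := hσ (f 3)
  have e0 := hps (f 0) (f 1)
  have e1 := hps (f 1) (f 2)
  simp only [Fin.reduceAdd] at h0 h1 h2 h3 n0 n1
  grind

/-- Among three edges, it is impossible that every two contain exactly one matching edge. -/
theorem claw_not_isIndContained_cliqueMatching :
    ¬ completeBipartiteGraph (Fin 1) (Fin 3) ⊴ cliqueMatching p σ hσ := by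
  rintro ⟨f⟩
  have alt (i j : Fin 3) (hij : i ≠ j) := cliqueMatching_alternates (p := p) (hσ := hσ)
    (u := f (.inr i)) (v := f (.inl 0)) (w := f (.inr j))
    (f.map_adj_iff.mpr (by simp)) (f.map_adj_iff.mpr (by simp))
    (fun h => absurd (f.map_adj_iff.mp h) (by simp))
    (fun h => hij (Sum.inr_injective (f.injective h)))
  have h0 := alt 0 1 (by decide)
  have h1 := alt 1 2 (by decide)
  have h2 := alt 2 0 (by decide)
  grind

theorem diamond_not_isIndContained_cliqueMatching (hp : ∀ u, p (σ u) ≠ p u) :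
    ¬ graphDiamond ⊴ cliqueMatching p σ hσ := by
  rintro ⟨f⟩
  have adj {x y} (h : graphDiamond.Adj x y) := f.map_adj_iff.mpr h
  have h1 := adj (x := .inr 0) (y := .inl (.inl 0)) (by simp)
  have h2 := adj (x := .inr 0) (y := .inl (.inr 0)) (by simp)
  have h3 := adj (x := .inr 1) (y := .inl (.inl 0)) (by simp)
  have h4 := adj (x := .inr 1) (y := .inl (.inr 0)) (by simp)
  have h5 := adj (x := .inl (.inl 0)) (y := .inl (.inr 0)) (by simp)
  have h6 : ¬ (cliqueMatching p σ hσ).Adj (f (.inr 0)) (f (.inr 1)) := fun h =>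
    absurd (f.map_adj_iff.mp h) (by simp [pathGraph_adj])
  -- Both non-adjacent vertices form a triangle with the same edge, so they share its fibre and
  -- would be adjacent.
  have e1 := cliqueMatching_triangle hp h1 h5 h2
  have e2 := cliqueMatching_triangle hp h3 h5 h4
  exact h6 ⟨fun h => by simpa using f.injective h, Or.inl (e1.trans e2.symm)⟩

theorem completeGraph_four_not_isIndContained_cliqueMatching (hp : ∀ u, p (σ u) ≠ p u)
    (hp3 : ∀ b, ∃ S : Finset V, #S ≤ 3 ∧ ∀ u, p u = b → u ∈ S) :
    ¬ (⊤ : SimpleGraph (Fin 4)) ⊴ cliqueMatching p σ hσ := by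
  rintro ⟨f⟩
  have adj {x y : Fin 4} (h : x ≠ y) := f.map_adj_iff.mpr ((top_adj x y).mpr h)
  have hpf (x : Fin 4) : p (f x) = p (f 0) := by
    rcases eq_or_ne x 0 with rfl | hx
    · rfl
    · obtain ⟨y, hxy, hy⟩ : ∃ y : Fin 4, x ≠ y ∧ y ≠ 0 := by revert x; decide
      exact cliqueMatching_triangle hp (adj hx) (adj hy.symm) (adj hxy)
  obtain ⟨S, hS, h⟩ := hp3 (p (f 0))
  have := card_le_card_of_injOn (s := univ) (t := S) f (fun x _ => h _ (hpf x))
    f.injective.injOn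
  rw [card_univ, Fintype.card_fin] at this
  omega

end cliqueMatching

/-! ### Truncated toroidal grids -/

/-- The matching of the truncated toroidal grid. The cell `(i, j)` consists of the triangles
`(i, j, false)`, linked to the triangles of the same kind in row `i`, and `(i, j, true)`, linked to
those in column `j`. -/
def torusMatching (m : ℕ) : ZMod m × ZMod m × Bool × Fin 3 → ZMod m × ZMod m × Bool × Fin 3
  | (i, j, false, 0) => (i, j + 1, false, 1)
  | (i, j, false, 1) => (i, j - 1, false, 0)
  | (i, j, true, 0) => (i + 1, j, true, 1)
  | (i, j, true, 1) => (i - 1, j, true, 0)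
  | (i, j, b, 2) => (i, j, !b, 2)

theorem torusMatching_involutive (m : ℕ) : Function.Involutive (torusMatching m) := by
  rintro ⟨i, j, b, c⟩
  cases b <;> fin_cases c <;> simp [torusMatching]

/-- The triangle of a vertex of the truncated toroidal grid. -/
def torusTriangle (m : ℕ) (u : ZMod m × ZMod m × Bool × Fin 3) : ZMod m × ZMod m × Bool :=
  (u.1, u.2.1, u.2.2.1)

theorem torusTriangle_torusMatching_ne {m : ℕ} [Fact (1 < m)]
    (u : ZMod m × ZMod m × Bool × Fin 3) :
    torusTriangle m (torusMatching m u) ≠ torusTriangle m u := by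
  obtain ⟨i, j, b, c⟩ := u
  cases b <;> fin_cases c <;> simp [torusMatching, torusTriangle]

theorem ZMod_two_ne_zero {m : ℕ} (hm : 2 < m) : (2 : ZMod m) ≠ 0 := by
  intro h
  have := (ZMod.natCast_eq_zero_iff 2 m).mp (by exact_mod_cast h)
  exact absurd (Nat.le_of_dvd two_pos this) (by omega)

theorem ZMod_add_one_ne_sub_one {m : ℕ} (hm : 2 < m) (x : ZMod m) : x + 1 ≠ x - 1 := by
  intro h
  refine ZMod_two_ne_zero hm ?_
  linear_combination h

/-- For `m = 2` the steps `+1` and `-1` coincide and give two links between the same triangles. -/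
theorem eq_of_torusTriangle_eq {m : ℕ} (hm : 2 < m) (u v : ZMod m × ZMod m × Bool × Fin 3)
    (h : torusTriangle m u = torusTriangle m v)
    (h' : torusTriangle m (torusMatching m u) = torusTriangle m (torusMatching m v)) : u = v := by
  obtain ⟨i, j, b, c⟩ := u
  obtain ⟨i', j', b', c'⟩ := v
  simp only [torusTriangle, Prod.mk.injEq] at h
  obtain ⟨rfl, rfl, rfl⟩ := h
  have hi := ZMod_add_one_ne_sub_one hm i
  have hj := ZMod_add_one_ne_sub_one hm j
  cases b <;> fin_cases c <;> fin_cases c' <;>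
    simp_all [torusMatching, torusTriangle, eq_comm]

/-- The truncated toroidal grid. -/
def truncatedTorus (m : ℕ) : SimpleGraph (ZMod m × ZMod m × Bool × Fin 3) :=
  cliqueMatching (torusTriangle m) (torusMatching m) (torusMatching_involutive m)

theorem exists_card_le_of_torusTriangle_eq {m : ℕ} (b : ZMod m × ZMod m × Bool) :
    ∃ S : Finset (ZMod m × ZMod m × Bool × Fin 3), #S ≤ 3 ∧ ∀ u, torusTriangle m u = b → u ∈ S := by
  classical
  refine ⟨univ.image fun c : Fin 3 => (b.1, b.2.1, b.2.2, c), card_image_le, ?_⟩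
  rintro u rfl
  exact mem_image.mpr ⟨u.2.2.2, mem_univ _, rfl⟩

/-- The bound 4 exceeds the degree by one because the triangle of `w` includes `w` itself. -/
theorem truncatedTorus_exists_card_le {m : ℕ} (w : ZMod m × ZMod m × Bool × Fin 3) :
    ∃ S : Finset (ZMod m × ZMod m × Bool × Fin 3),
      #S ≤ 4 ∧ ∀ u, (truncatedTorus m).Adj u w → u ∈ S := by
  classical
  obtain ⟨S, hS, h⟩ := exists_card_le_of_torusTriangle_eq (torusTriangle m w)
  refine ⟨insert (torusMatching m w) S, (card_insert_le _ _).trans (by omega), ?_⟩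
  rintro u ⟨-, hu | rfl⟩
  · exact mem_insert_of_mem (h u hu)
  · exact mem_insert.mpr (Or.inl (torusMatching_involutive m u).symm)

theorem truncatedTorus_mem_freeClass {m : ℕ} [NeZero m] (hm : 2 < m) :
    (truncatedTorus m).toFiniteGraph ∈
      freeClass {graphC4.toFiniteGraph, graphC5.toFiniteGraph, graphClaw.toFiniteGraph,
        graphK4.toFiniteGraph, graphDiamond.toFiniteGraph} := by
  have : Fact (1 < m) := ⟨by omega⟩
  rintro H (rfl | rfl | rfl | rfl | rfl)
  · exact cycleGraph_four_not_isIndContained_cliqueMatching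
      (hσ := torusMatching_involutive m) (eq_of_torusTriangle_eq hm)
  · exact cycleGraph_five_not_isIndContained_cliqueMatching
      (hσ := torusMatching_involutive m)
  · exact claw_not_isIndContained_cliqueMatching
      (hσ := torusMatching_involutive m)
  · exact completeGraph_four_not_isIndContained_cliqueMatching
      (hσ := torusMatching_involutive m) torusTriangle_torusMatching_ne
      exists_card_le_of_torusTriangle_eq
  · exact diamond_not_isIndContained_cliqueMatching
      (hσ := torusMatching_involutive m) torusTriangle_torusMatching_ne

/-! ### Connectivity of rows and columns, and isoperimetry -/

theorem ZMod_induction {m : ℕ} [NeZero m] {P : ZMod m → Prop} (h : ∀ x, P x → P (x + 1))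
    (x y : ZMod m) (hx : P x) : P y := by
  have key (n : ℕ) : P (x + n) := by
    induction n with
    | zero => simpa using hx
    | succ n ih => simpa [add_assoc] using h _ ih
  simpa using key (y - x).val

theorem truncatedTorus_adj_triangle {m : ℕ} (i j : ZMod m) (b : Bool) {c c' : Fin 3} (h : c ≠ c') :
    (truncatedTorus m).Adj (i, j, b, c) (i, j, b, c') :=
  ⟨fun e => h (by simpa using e), Or.inl rfl⟩

theorem truncatedTorus_adj_cell {m : ℕ} (i j : ZMod m) (b : Bool) :
    (truncatedTorus m).Adj (i, j, b, 2) (i, j, !b, 2) :=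
  ⟨by simp, Or.inr (by cases b <;> rfl)⟩

theorem truncatedTorus_adj_row {m : ℕ} [Fact (1 < m)] (i j : ZMod m) :
    (truncatedTorus m).Adj (i, j, false, 0) (i, j + 1, false, 1) :=
  ⟨by simp, Or.inr rfl⟩

theorem truncatedTorus_adj_column {m : ℕ} [Fact (1 < m)] (i j : ZMod m) :
    (truncatedTorus m).Adj (i, j, true, 0) (i + 1, j, true, 1) :=
  ⟨by simp, Or.inr rfl⟩

theorem truncatedTorus_cell_connected {m : ℕ} {P : ZMod m × ZMod m × Bool × Fin 3 → Prop}
    {i j : ZMod m} (h : ∀ s s', (truncatedTorus m).Adj (i, j, s) (i, j, s') →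
      P (i, j, s) → P (i, j, s')) {s : Bool × Fin 3} (hs : P (i, j, s)) (s' : Bool × Fin 3) :
    P (i, j, s') := by
  obtain ⟨b, c⟩ := s
  obtain ⟨b', c'⟩ := s'
  have tri (b : Bool) (c c' : Fin 3) (hc : P (i, j, b, c)) : P (i, j, b, c') := by
    rcases eq_or_ne c c' with rfl | hcc
    · exact hc
    · exact h _ _ (truncatedTorus_adj_triangle i j b hcc) hc
  have h2 := tri b c 2 hs
  rcases Bool.eq_or_eq_not b' b with rfl | rfl
  · exact tri _ _ _ h2
  · exact tri _ _ _ (h _ _ (truncatedTorus_adj_cell i j b) h2)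

/-- Connectivity takes the form of propagating a predicate, later membership in `A`. Forward links
suffice because the row is cyclic. -/
theorem truncatedTorus_row_connected {m : ℕ} [NeZero m] [Fact (1 < m)]
    {P : ZMod m × ZMod m × Bool × Fin 3 → Prop} {i : ZMod m}
    (h : ∀ x y, (truncatedTorus m).Adj (i, x) (i, y) → P (i, x) → P (i, y))
    {x : ZMod m × Bool × Fin 3} (hx : P (i, x)) (y : ZMod m × Bool × Fin 3) : P (i, y) := by
  have cell (j : ZMod m) {s} (hs : P (i, j, s)) (s') : P (i, j, s') :=
    truncatedTorus_cell_connected (fun _ _ => h _ _) hs s'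
  exact cell _ (ZMod_induction (P := fun j => P (i, j, false, 0))
    (fun j hj => cell _ (h _ _ (truncatedTorus_adj_row i j) hj) _) x.1 y.1
    (cell x.1 hx (false, 0))) _

theorem truncatedTorus_column_connected {m : ℕ} [NeZero m] [Fact (1 < m)]
    {P : ZMod m × ZMod m × Bool × Fin 3 → Prop} {j : ZMod m}
    (h : ∀ i i' s s', (truncatedTorus m).Adj (i, j, s) (i', j, s') → P (i, j, s) → P (i', j, s'))
    {i : ZMod m} {s : Bool × Fin 3} (hs : P (i, j, s)) (i' : ZMod m) (s' : Bool × Fin 3) :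
    P (i', j, s') := by
  have cell (i : ZMod m) {s} (hs : P (i, j, s)) (s') : P (i, j, s') :=
    truncatedTorus_cell_connected (fun _ _ => h _ _ _ _) hs s'
  exact cell _ (ZMod_induction (P := fun i => P (i, j, true, 0))
    (fun i hi => cell _ (h _ _ _ _ (truncatedTorus_adj_column i j) hi) _) i i'
    (cell i hs (true, 0))) _

/-- A set of vertices with a small boundary is small or has a small complement. -/
theorem truncatedTorus_isoperimetric {m : ℕ} [NeZero m] [Fact (1 < m)]
    (A : Finset (ZMod m × ZMod m × Bool × Fin 3))
    (hA : #((truncatedTorus m).innerBoundary A) < m) :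
    #A ≤ #((truncatedTorus m).innerBoundary A) * (6 * m) ∨
      #Aᶜ ≤ #((truncatedTorus m).innerBoundary A) * (6 * m) := by
  set D := (truncatedTorus m).innerBoundary A with hD
  let R := D.image fun u => u.1
  let C := D.image fun u => u.2.1
  -- An edge leaving `A` within a row would put a boundary vertex there, so a boundary-free row lies
  -- in `A` or misses it.
  have hR (i) (hi : i ∉ R) (x y) (hx : (i, x) ∈ A) : (i, y) ∈ A :=
    truncatedTorus_row_connected (P := (· ∈ A)) (fun x y hxy hx => by
      by_contra hy
      exact hi (mem_image.mpr ⟨_, mem_innerBoundary.mpr ⟨hx, _, hy, hxy⟩, rfl⟩)) hx y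
  have hC (j) (hj : j ∉ C) (i s i' s') (hx : (i, j, s) ∈ A) : (i', j, s') ∈ A :=
    truncatedTorus_column_connected (P := (· ∈ A)) (fun i i' s s' hxy hx => by
      by_contra hy
      exact hj (mem_image.mpr ⟨_, mem_innerBoundary.mpr ⟨hx, _, hy, hxy⟩, rfl⟩)) hx i' s'
  obtain ⟨j, hj⟩ : ∃ j, j ∉ C := by
    by_contra! h
    have : #C = m := by rw [eq_univ_of_forall h, card_univ, ZMod.card]
    have : #C ≤ #D := card_image_le
    omega
  have hcard : #(R ×ˢ (univ : Finset (ZMod m × Bool × Fin 3))) ≤ #D * (6 * m) := by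
    rw [card_product, card_univ, Fintype.card_prod, Fintype.card_prod, ZMod.card,
      Fintype.card_bool, Fintype.card_fin]
    exact Nat.mul_le_mul card_image_le (by omega)
  -- The boundary-free column `j` is on one side of the cut and meets every row. All boundary-free
  -- rows are then on that side, so the other side lies in the rows of `R`.
  by_cases h0 : ((0, j, false, 0) : ZMod m × ZMod m × Bool × Fin 3) ∈ A
  · refine Or.inr ((card_le_card fun u hu => ?_).trans hcard)
    refine mem_product.mpr ⟨?_, mem_univ _⟩
    by_contra hu'
    exact mem_compl.mp hu (hR u.1 hu' (j, false, 0) u.2 (hC j hj _ _ _ _ h0))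
  · refine Or.inl ((card_le_card fun u hu => ?_).trans hcard)
    refine mem_product.mpr ⟨?_, mem_univ _⟩
    by_contra hu'
    exact h0 (hC j hj u.1 (false, 0) _ _ (hR u.1 hu' u.2 _ hu))

theorem lt_cliqueWidth_truncatedTorus {m c : ℕ} (hm : 1 < m) (hc : 12 * c < m) :
    c < (truncatedTorus m).cliqueWidth := by
  by_contra! h
  have : NeZero m := ⟨by omega⟩
  have : Fact (1 < m) := ⟨hm⟩
  obtain ⟨k, hk, hG⟩ := exists_constructibleWith_of_cliqueWidth_le h
  have hV : Fintype.card (ZMod m × ZMod m × Bool × Fin 3) = 6 * (m * m) := by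
    simp only [Fintype.card_prod, ZMod.card, Fintype.card_bool, Fintype.card_fin]
    ring
  have hmm : 0 < m * m := by positivity
  -- A third of the `6 * (m * m)` vertices, so that both `A` and its complement have at least `2 *
  -- (m * m)`.
  obtain ⟨A, l, h1, h2, h3⟩ := hG.exists_cut (N := 2 * (m * m)) (by omega) (by omega)
  have hD := card_innerBoundary_le l h3 truncatedTorus_exists_card_le
  have hiso := truncatedTorus_isoperimetric A
  generalize #((truncatedTorus m).innerBoundary A) = d at hD hiso
  -- From `d ≤ 4 * k ≤ 4 * c` and `12 * c < m`.
  have hd : 3 * d + 1 ≤ m := by omega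
  have hdm : (3 * d + 1) * m ≤ m * m := Nat.mul_le_mul_right m hd
  have hlt : d * (6 * m) < 2 * (m * m) := by nlinarith
  have hcompl := card_compl A
  rcases hiso (by omega) with h | h <;> omega

end SimpleGraph

open SimpleGraph in
theorem mainTheorem7 :
    ¬ HasBoundedCliqueWidth
      (freeClass {graphC4.toFiniteGraph, graphC5.toFiniteGraph, graphClaw.toFiniteGraph,
        graphK4.toFiniteGraph, graphDiamond.toFiniteGraph}) := by
  rintro ⟨c, hc⟩
  -- The summand 3 gives `m > 2`, needed to exclude `C₄`, even for `c = 0`.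
  have : NeZero (12 * c + 3) := ⟨by omega⟩
  exact absurd (hc _ (truncatedTorus_mem_freeClass (m := 12 * c + 3) (by omega)))
    (not_le.mpr (lt_cliqueWidth_truncatedTorus (by omega) (by omega)))
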